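/- \textbf{Terms.} Terms of the $\lambda\bot$-calculus, $M ::= x \mid \bot \mid \lambda x.M \mid MM$ (with countably many variables, modulo renaming of bound variables), have the reduction rules $(\lambda x.M)N\to M\{N/x\}$, $\bot M\to\bot$, $\lambda x.\bot\to\bot$, applied in any context; $M=N$ means that $M$ and $N$ reduce to a common term. Let $\mathbf I=\lambda x.x$, $\mathbf B=\lambda xyz.x(yz)$ and $M\circ N=\mathbf BMN$. \textbf{Standard types.} Standard intersection types are $\sigma ::= \varphi\mid\omega\mid\sigma\to\sigma\mid\sigma\wedge\sigma$ ($\varphi$ ranging over countably many type variables), with $\wedge$ taken modulo idempotence, commutativity and associativity. Let $\le$ be the least preorder with $\sigma\le\omega$, $\omega\le\omega\to\omega$, $\sigma_1\wedge\sigma_2\le\sigma_i$, $\wedge$ monotone in both arguments, $\to$ antitone in the first and monotone in the second argument, and $(\sigma\to\tau)\wedge(\sigma\to\rho)\le\sigma\to\tau\wedge\rho$. The judgements $\Gamma\vdash M:\sigma$ are generated by $\Gamma,x:\sigma\vdash x:\sigma$; $\Gamma\vdash M:\omega$; subsumption along $\le$; the introduction and elimination rules of $\to$; and the introduction rule of $\wedge$.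 \textbf{Strict types.} Strict types are $\mu::=\varphi\mid\omega\mid\sigma\to\mu$, where now $\sigma::=\mu\mid\sigma\wedge\sigma$. For the strict system $\le$ is defined on these $\sigma$ by the same rules except the last one, and the judgements $\Gamma\vdash M:\mu$ (with $\mu$ strict) are generated by $\Gamma,x:\bigwedge_{i\in I}\mu_i\vdash x:\mu_j$ ($j\in I$); $\Gamma\vdash M:\omega$; subsumption; and the rules for $\to$, where $\Gamma\vdash N:\bigwedge_{i\in I}\mu_i$ abbreviates $\Gamma\vdash N:\mu_i$ for all $i\in I$. \textbf{Retraction.} In either system, $\sigma\lhd\tau$ means that there are terms $L,R$ with $\vdash L:\tau\to\sigma$, $\vdash R:\sigma\to\tau$ and $L\circ R=\mathbf I$. \textbf{Models.} A model of the $\lambda\bot$-calculus is $\mathcal M=\langle D,\cdot,[\![-]\!]^{\mathcal M},d_0\rangle$ such that for all terms, all $d,e\in D$ and all $\mathcal V,\mathcal V'$ from term variables to $D$: \begin{itemize} \item $d_0\cdot e=d_0$ and $[\![\bot]\!]_{\mathcal V}=[\![\lambda x.\bot]\!]_{\mathcal V}=d_0$; \item $[\![x]\!]_{\mathcal V}=\mathcal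 V(x)$, $[\![MN]\!]_{\mathcal V}=[\![M]\!]_{\mathcal V}\cdot[\![N]\!]_{\mathcal V}$ and $[\![\lambda x.M]\!]_{\mathcal V}\cdot d=[\![M]\!]_{\mathcal V[d/x]}$; \item if $\mathcal V$ and $\mathcal V'$ agree on the free variables of $M$, then $[\![M]\!]_{\mathcal V}=[\![M]\!]_{\mathcal V'}$; \item $[\![\lambda x.M]\!]_{\mathcal V}=[\![\lambda y.M\{y/x\}]\!]_{\mathcal V}$ if $y$ is not in $M$; \item if $[\![M]\!]_{\mathcal V[d/x]}=[\![N]\!]_{\mathcal V[d/x]}$ for all $d\in D$, then $[\![\lambda x.M]\!]_{\mathcal V}=[\![\lambda x.N]\!]_{\mathcal V}$. \end{itemize} For $\mathcal W$ from type variables to subsets of $D$, let $[\![\varphi]\!]_{\mathcal W}=\mathcal W(\varphi)$, $[\![\omega]\!]_{\mathcal W}=D$, $[\![\sigma\to\tau]\!]_{\mathcal W}=\{d\mid \forall e\in[\![\sigma]\!]_{\mathcal W},\ d\cdot e\in[\![\tau]\!]_{\mathcal W}\}$ and $[\![\sigma\wedge\tau]\!]_{\mathcal W}=[\![\sigma]\!]_{\mathcal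 W}\cap[\![\tau]\!]_{\mathcal W}$. For $d,e\in D$ let $d\circ e=[\![\mathbf B]\!]\cdot d\cdot e$. \textbf{Semantic retraction.} $\sigma\blacktriangleleft\tau$ means that there are terms $L,R$ such that for all models $\mathcal M$ and all $\mathcal V,\mathcal W$: $[\![R]\!]_{\mathcal V}\in[\![\sigma\to\tau]\!]_{\mathcal W}$, $[\![L]\!]_{\mathcal V}\in[\![\tau\to\sigma]\!]_{\mathcal W}$ and $[\![L]\!]_{\mathcal V}\circ[\![R]\!]_{\mathcal V}=[\![\mathbf I]\!]_{\mathcal V}$. \textbf{Theorem} (retraction coincides with semantic retraction). For all standard intersection types $\sigma,\tau$, $\sigma\lhd\tau$ in the standard system if and only if $\sigma\blacktriangleleft\tau$. Likewise, for all strict types $\mu,\nu$, $\mu\lhd\nu$ in the strict system if and only if $\mu\blacktriangleleft\nu$. -/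

import Mathlib

universe u

namespace LambdaBot

/-! ## Terms of the lambda-bottom calculus -/

/-- Terms `M ::= x | ⊥ | λx.M | M M`, taken modulo renaming of bound variables by means of
de Bruijn indices. A free variable is an index that points outside all the binders. -/
inductive Term : Type
  | var : ℕ → Term
  | bot : Term
  | lam : Term → Term
  | app : Term → Term → Term

namespace Term

/-- `FreeIn n M`: the variable `n` occurs free in `M`. -/
def FreeIn : ℕ → Term → Prop
  | n, var m => n = m
  | _, bot => False
  | n, lam M => FreeIn (n + 1) M
  | n, app M N => FreeIn n M ∨ FreeIn n N

/-- A renaming of variables moved below a binder. -/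
def upRen (f : ℕ → ℕ) : ℕ → ℕ
  | 0 => 0
  | n + 1 => f n + 1

/-- Renaming of the free variables. -/
def rename : (ℕ → ℕ) → Term → Term
  | f, var n => var (f n)
  | _, bot => bot
  | f, lam M => lam (rename (upRen f) M)
  | f, app M N => app (rename f M) (rename f N)

/-- A substitution moved below a binder. -/
def up (s : ℕ → Term) : ℕ → Term
  | 0 => var 0
  | n + 1 => rename Nat.succ (s n)

/-- Simultaneous capture-avoiding substitution of `s n` for each free variable `n`. -/
def subst : (ℕ → Term) → Term → Term
  | s, var n => s n
  | _, bot => bot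
  | s, lam M => lam (subst (up s) M)
  | s, app M N => app (subst s M) (subst s N)

/-- The substitution that replaces the variable of the outermost binder by `N`. -/
def single (N : Term) : ℕ → Term
  | 0 => N
  | n + 1 => var n

/-- If `M` is the body of `λx.M`, then `inst M N` is `M{N/x}`. -/
def inst (M N : Term) : Term := subst (single N) M

/-- One step of reduction: the three rules, closed under all term contexts. -/
inductive Step : Term → Term → Prop
  | beta (M N : Term) : Step (app (lam M) N) (inst M N)
  | bot_app (M : Term) : Step (app bot M) bot
  | lam_bot : Step (lam bot) bot
  | lam {M M' : Term} : Step M M' → Step (lam M) (lam M')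
  | app_left {M M' : Term} (N : Term) : Step M M' → Step (app M N) (app M' N)
  | app_right (M : Term) {N N' : Term} : Step N N' → Step (app M N) (app M N')

/-- Reduction in any finite number of steps. -/
def Reduces : Term → Term → Prop := Relation.ReflTransGen Step

/-- Equality of terms: reduction to a common term. -/
def Conv (M N : Term) : Prop := ∃ P : Term, Reduces M P ∧ Reduces N P

/-- `I = λx.x`. -/
def I : Term := lam (var 0)

/-- `B = λxyz.x(yz)`. -/
def B : Term := lam (lam (lam (app (var 2) (app (var 1) (var 0)))))

/-- `M ∘ N = B M N`. -/
def comp (M N : Term) : Term := app (app B M) N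

end Term

/-! ## Standard intersection types -/

/-- Intersection types `σ ::= φ | ω | σ → σ | σ ∧ σ`. -/
inductive Ty : Type
  | var : ℕ → Ty
  | omega : Ty
  | arrow : Ty → Ty → Ty
  | inter : Ty → Ty → Ty

/-- The preorder on intersection types. Intersections are taken modulo idempotence,
commutativity and associativity: `dup` makes `σ` and `σ ∧ σ` equivalent, and together with
the other rules it also yields the equivalences for commutativity and associativity. -/
inductive Ty.Le : Ty → Ty → Prop
  | refl (σ : Ty) : Ty.Le σ σ
  | trans {σ τ ρ : Ty} : Ty.Le σ τ → Ty.Le τ ρ → Ty.Le σ ρ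
  | le_omega (σ : Ty) : Ty.Le σ .omega
  | omega_le : Ty.Le .omega (.arrow .omega .omega)
  | inter_left (σ τ : Ty) : Ty.Le (.inter σ τ) σ
  | inter_right (σ τ : Ty) : Ty.Le (.inter σ τ) τ
  | dup (σ : Ty) : Ty.Le σ (.inter σ σ)
  | inter_mono {σ₁ σ₂ τ₁ τ₂ : Ty} :
      Ty.Le σ₁ τ₁ → Ty.Le σ₂ τ₂ → Ty.Le (.inter σ₁ σ₂) (.inter τ₁ τ₂)
  | arrow_mono {σ₁ σ₂ τ₁ τ₂ : Ty} :
      Ty.Le σ₂ σ₁ → Ty.Le τ₁ τ₂ → Ty.Le (.arrow σ₁ τ₁) (.arrow σ₂ τ₂)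
  | arrow_inter (σ τ ρ : Ty) :
      Ty.Le (.inter (.arrow σ τ) (.arrow σ ρ)) (.arrow σ (.inter τ ρ))

/-- Typing judgements `Γ ⊢ M : σ` of the standard system. The environment is the list of the
types of the variables `0, 1, …, Γ.length - 1`; the other variables are not declared. -/
inductive Typed : List Ty → Term → Ty → Prop
  | ax {Γ : List Ty} {n : ℕ} {σ : Ty} : Γ[n]? = some σ → Typed Γ (.var n) σ
  | omega (Γ : List Ty) (M : Term) : Typed Γ M .omega
  | sub {Γ : List Ty} {M : Term} {σ τ : Ty} : Typed Γ M σ → Ty.Le σ τ → Typed Γ M τ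
  | lam {Γ : List Ty} {M : Term} {σ τ : Ty} :
      Typed (σ :: Γ) M τ → Typed Γ (.lam M) (.arrow σ τ)
  | app {Γ : List Ty} {M N : Term} {σ τ : Ty} :
      Typed Γ M (.arrow σ τ) → Typed Γ N σ → Typed Γ (.app M N) τ
  | inter {Γ : List Ty} {M : Term} {σ τ : Ty} :
      Typed Γ M σ → Typed Γ M τ → Typed Γ M (.inter σ τ)

/-- `σ ◁ τ` in the standard system. -/
def Retract (σ τ : Ty) : Prop :=
  ∃ L R : Term, Typed [] L (.arrow τ σ) ∧ Typed [] R (.arrow σ τ) ∧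
    Term.Conv (Term.comp L R) Term.I

/-! ## Strict intersection types -/

mutual

/-- Strict types `μ ::= φ | ω | σ → μ`, where `σ` is an intersection of strict types. -/
inductive Ty.IsStrict : Ty → Prop
  | var (n : ℕ) : Ty.IsStrict (.var n)
  | omega : Ty.IsStrict .omega
  | arrow {σ μ : Ty} : Ty.IsInter σ → Ty.IsStrict μ → Ty.IsStrict (.arrow σ μ)

/-- Intersections of strict types `σ ::= μ | σ ∧ σ`. -/
inductive Ty.IsInter : Ty → Prop
  | strict {μ : Ty} : Ty.IsStrict μ → Ty.IsInter μ
  | inter {σ τ : Ty} : Ty.IsInter σ → Ty.IsInter τ → Ty.IsInter (.inter σ τ)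

end

/-- The components `μ₁, …, μₖ` of `σ = μ₁ ∧ … ∧ μₖ`. -/
def Ty.components : Ty → List Ty
  | .inter σ τ => Ty.components σ ++ Ty.components τ
  | .var n => [.var n]
  | .omega => [.omega]
  | .arrow σ τ => [.arrow σ τ]

/-- The preorder on intersections of strict types. As above, `dup` accounts for the
identification of intersections modulo idempotence, commutativity and associativity. -/
inductive Ty.StrictLe : Ty → Ty → Prop
  | refl {σ : Ty} : Ty.IsInter σ → Ty.StrictLe σ σ
  | trans {σ τ ρ : Ty} : Ty.StrictLe σ τ → Ty.StrictLe τ ρ → Ty.StrictLe σ ρ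
  | le_omega {σ : Ty} : Ty.IsInter σ → Ty.StrictLe σ .omega
  | omega_le : Ty.StrictLe .omega (.arrow .omega .omega)
  | inter_left {σ τ : Ty} : Ty.IsInter σ → Ty.IsInter τ → Ty.StrictLe (.inter σ τ) σ
  | inter_right {σ τ : Ty} : Ty.IsInter σ → Ty.IsInter τ → Ty.StrictLe (.inter σ τ) τ
  | dup {σ : Ty} : Ty.IsInter σ → Ty.StrictLe σ (.inter σ σ)
  | inter_mono {σ₁ σ₂ τ₁ τ₂ : Ty} :
      Ty.StrictLe σ₁ τ₁ → Ty.StrictLe σ₂ τ₂ → Ty.StrictLe (.inter σ₁ σ₂) (.inter τ₁ τ₂)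
  | arrow_mono {σ₁ σ₂ μ₁ μ₂ : Ty} : Ty.IsStrict μ₁ → Ty.IsStrict μ₂ →
      Ty.StrictLe σ₂ σ₁ → Ty.StrictLe μ₁ μ₂ → Ty.StrictLe (.arrow σ₁ μ₁) (.arrow σ₂ μ₂)

/-- Typing judgements `Γ ⊢ M : μ` of the strict system. The second premise of `app` says
`Γ ⊢ N : σ`, that is, `Γ ⊢ N : ν` for each component `ν` of the intersection `σ`. -/
inductive StrictTyped : List Ty → Term → Ty → Prop
  | ax {Γ : List Ty} {n : ℕ} {σ μ : Ty} :
      Γ[n]? = some σ → μ ∈ σ.components → StrictTyped Γ (.var n) μ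
  | omega (Γ : List Ty) (M : Term) : StrictTyped Γ M .omega
  | sub {Γ : List Ty} {M : Term} {μ ν : Ty} : Ty.IsStrict μ → Ty.IsStrict ν →
      StrictTyped Γ M μ → Ty.StrictLe μ ν → StrictTyped Γ M ν
  | lam {Γ : List Ty} {M : Term} {σ μ : Ty} : Ty.IsInter σ →
      StrictTyped (σ :: Γ) M μ → StrictTyped Γ (.lam M) (.arrow σ μ)
  | app {Γ : List Ty} {M N : Term} {σ μ : Ty} : StrictTyped Γ M (.arrow σ μ) →
      (∀ ν ∈ σ.components, StrictTyped Γ N ν) → StrictTyped Γ (.app M N) μ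

/-- `μ ◁ ν` in the strict system, for strict types `μ` and `ν`. Since `ν` and `μ` are strict
rather than proper intersections, the arrow types below are strict types. -/
def StrictRetract (μ ν : Ty) : Prop :=
  ∃ L R : Term, StrictTyped [] L (.arrow ν μ) ∧ StrictTyped [] R (.arrow μ ν) ∧
    Term.Conv (Term.comp L R) Term.I

/-! ## Models -/

/-- The valuation `V[d/x]`, where `x` is the variable of a new outermost binder. -/
def extend {D : Type u} (d : D) (V : ℕ → D) : ℕ → D
  | 0 => d
  | n + 1 => V n

/-- Hindley-Longo models of the lambda-bottom calculus with domain `D`. The condition that the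
interpretation respects renaming of bound variables holds by itself, because terms that differ
only in that respect are equal here. -/
structure Model (D : Type u) where
  /-- The application of the model. -/
  app : D → D → D
  /-- The interpretation of terms under a valuation of the variables. -/
  interp : Term → (ℕ → D) → D
  /-- The distinguished element. -/
  d₀ : D
  d₀_app : ∀ e : D, app d₀ e = d₀
  interp_var : ∀ (n : ℕ) (V : ℕ → D), interp (.var n) V = V n
  interp_app : ∀ (M N : Term) (V : ℕ → D),
    interp (.app M N) V = app (interp M V) (interp N V)
  interp_lam : ∀ (M : Term) (V : ℕ → D) (d : D),
    app (interp (.lam M) V) d = interp M (extend d V)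
  interp_congr : ∀ (M : Term) (V V' : ℕ → D),
    (∀ n : ℕ, Term.FreeIn n M → V n = V' n) → interp M V = interp M V'
  interp_ext : ∀ (M N : Term) (V : ℕ → D),
    (∀ d : D, interp M (extend d V) = interp N (extend d V)) →
      interp (.lam M) V = interp (.lam N) V
  interp_bot : ∀ V : ℕ → D, interp .bot V = d₀
  interp_lam_bot : ∀ V : ℕ → D, interp (.lam .bot) V = d₀

/-- Composition in a model, `d ∘ e = ⟦B⟧ · d · e`; as `B` is closed, the valuation used to
interpret it is irrelevant. -/
def Model.comp {D : Type u} (𝓜 : Model D) (d e : D) : D :=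
  𝓜.app (𝓜.app (𝓜.interp Term.B (fun _ => 𝓜.d₀)) d) e

/-- The standard interpretation of types under an assignment `W` of subsets of the domain to
the type variables. Strict types are interpreted by the same clauses. -/
def Model.tyInterp {D : Type u} (𝓜 : Model D) (W : ℕ → Set D) : Ty → Set D
  | .var n => W n
  | .omega => Set.univ
  | .arrow σ τ => {d | ∀ e ∈ 𝓜.tyInterp W σ, 𝓜.app d e ∈ 𝓜.tyInterp W τ}
  | .inter σ τ => 𝓜.tyInterp W σ ∩ 𝓜.tyInterp W τ

/-- `σ` is a semantic retract of `τ`. -/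
def SemanticRetract (σ τ : Ty) : Prop :=
  ∃ L R : Term, ∀ (D : Type u) (𝓜 : Model D) (V : ℕ → D) (W : ℕ → Set D),
    𝓜.interp R V ∈ 𝓜.tyInterp W (.arrow σ τ) ∧
    𝓜.interp L V ∈ 𝓜.tyInterp W (.arrow τ σ) ∧
    𝓜.comp (𝓜.interp L V) (𝓜.interp R V) = 𝓜.interp Term.I V

end LambdaBot

namespace LambdaBot

namespace Term

/-! ## Substitution calculus -/

-- The same terms `L` and `R` witness both notions, so the theorem is soundness and completeness of
-- the two ingredients, the typings and the equation `L ∘ R = I`.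
--
-- Soundness: derivable typings hold under every interpretation of types (`Typed.interp_mem`), and
-- convertible terms have equal values in every model (`interp_conv`).
--
-- Completeness needs only two models. Terms modulo convertibility form a model in which equality is
-- convertibility, which gives the equation (`conv_of_interp_eq`); confluence is needed here to make
-- convertibility transitive. Filters of types form a model in which, with type variables read as
-- the filters containing them, a filter belongs to the interpretation of a type exactly when it
-- contains that type (`mem_tyInterp_filterModel`). Since the types in the value of a term are
-- derivable for it (`typed_of_mem_eval`), semantic membership yields a typing
-- (`typed_nil_of_interp_mem`).
--
-- The strict case follows from the standard one because the semantics is shared. Distributing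
-- arrows over intersections on their right (`star`) translates standard derivations into strict
-- ones and fixes strict types, so both systems assign the same strict types to terms in the empty
-- environment (`strictTyped_iff_typed`).

theorem up_comp_upRen (s : ℕ → Term) (f : ℕ → ℕ) : up s ∘ upRen f = up (s ∘ f) := by
  funext n
  cases n <;> rfl

theorem up_var : up var = var := by
  funext n
  cases n <;> rfl

theorem up_var_comp (f : ℕ → ℕ) : up (var ∘ f) = var ∘ upRen f := by
  funext n
  cases n <;> rfl

theorem subst_var (M : Term) : subst var M = M := by
  induction M with
  | var n => rfl
  | bot => rfl
  | lam M ih => simp only [subst, up_var, ih]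
  | app M N ihM ihN => simp only [subst, ihM, ihN]

theorem rename_eq_subst (f : ℕ → ℕ) (M : Term) : rename f M = subst (var ∘ f) M := by
  induction M generalizing f with
  | var n => rfl
  | bot => rfl
  | lam M ih => simp only [rename, subst, up_var_comp, ih]
  | app M N ihM ihN => simp only [rename, subst, ihM, ihN]

theorem subst_rename (s : ℕ → Term) (f : ℕ → ℕ) (M : Term) :
    subst s (rename f M) = subst (s ∘ f) M := by
  induction M generalizing s f with
  | var n => rfl
  | bot => rfl
  | lam M ih => simp only [rename, subst, ih, up_comp_upRen]
  | app M N ihM ihN => simp only [rename, subst, ihM, ihN]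

theorem rename_rename (f g : ℕ → ℕ) (M : Term) :
    rename f (rename g M) = rename (f ∘ g) M := by
  rw [rename_eq_subst f, subst_rename, rename_eq_subst (f ∘ g)]
  rfl

theorem rename_comp_up (f : ℕ → ℕ) (s : ℕ → Term) :
    rename (upRen f) ∘ up s = up (rename f ∘ s) := by
  funext n
  cases n with
  | zero => rfl
  | succ n =>
    simp only [Function.comp, up, rename_rename]
    rfl

theorem rename_subst (f : ℕ → ℕ) (s : ℕ → Term) (M : Term) :
    rename f (subst s M) = subst (rename f ∘ s) M := by
  induction M generalizing s f with
  | var n => rfl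
  | bot => rfl
  | lam M ih => simp only [rename, subst, ih, rename_comp_up]
  | app M N ihM ihN => simp only [rename, subst, ihM, ihN]

theorem subst_comp_up (t s : ℕ → Term) : subst (up t) ∘ up s = up (subst t ∘ s) := by
  funext n
  cases n with
  | zero => rfl
  | succ n =>
    simp only [Function.comp, up, subst_rename, rename_subst]
    rfl

theorem subst_subst (t s : ℕ → Term) (M : Term) :
    subst t (subst s M) = subst (subst t ∘ s) M := by
  induction M generalizing s t with
  | var n => rfl
  | bot => rfl
  | lam M ih => simp only [subst, ih, subst_comp_up]
  | app M N ihM ihN => simp only [subst, ihM, ihN]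

theorem inst_subst_up (s : ℕ → Term) (M N : Term) :
    inst (subst (up s) M) N = subst (fun n => Nat.casesOn n N s) M := by
  rw [inst, subst_subst]
  congr 1
  funext n
  cases n with
  | zero => rfl
  | succ n =>
    simp only [Function.comp, up, subst_rename]
    exact subst_var _

theorem subst_inst (t : ℕ → Term) (M N : Term) :
    subst t (inst M N) = inst (subst (up t) M) (subst t N) := by
  rw [inst_subst_up, inst, subst_subst]
  congr 1
  funext n
  cases n <;> rfl

theorem rename_inst (f : ℕ → ℕ) (M N : Term) :
    rename f (inst M N) = inst (rename (upRen f) M) (rename f N) := by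
  simp only [rename_eq_subst, subst_inst, up_var_comp]

theorem subst_congr {M : Term} {s t : ℕ → Term} (h : ∀ n, FreeIn n M → s n = t n) :
    subst s M = subst t M := by
  induction M generalizing s t with
  | var n => exact h n rfl
  | bot => rfl
  | lam M ih =>
    simp only [subst]
    rw [ih]
    intro n hn
    cases n with
    | zero => rfl
    | succ n => simp only [up, h n hn]
  | app M N ihM ihN =>
    simp only [subst]
    rw [ihM fun n hn => h n (Or.inl hn), ihN fun n hn => h n (Or.inr hn)]

theorem exists_freeIn_lt (M : Term) : ∃ b, ∀ n, FreeIn n M → n < b := by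
  induction M with
  | var m => exact ⟨m + 1, fun n hn => by simp only [FreeIn] at hn; omega⟩
  | bot => exact ⟨0, fun _ h => h.elim⟩
  | lam M ih =>
    obtain ⟨b, hb⟩ := ih
    exact ⟨b, fun n hn => by have := hb _ hn; omega⟩
  | app M N ihM ihN =>
    obtain ⟨b, hb⟩ := ihM
    obtain ⟨c, hc⟩ := ihN
    refine ⟨max b c, fun n hn => ?_⟩
    rcases hn with hn | hn
    · exact lt_max_of_lt_left (hb _ hn)
    · exact lt_max_of_lt_right (hc _ hn)

theorem FreeIn.of_rename {f : ℕ → ℕ} {M : Term} {m : ℕ} (h : FreeIn m (rename f M)) :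
    ∃ n, FreeIn n M ∧ m = f n := by
  induction M generalizing f m with
  | var n => exact ⟨n, rfl, h⟩
  | bot => exact h.elim
  | lam M ih =>
    obtain ⟨n, hn, e⟩ := ih h
    cases n with
    | zero => simp [upRen] at e
    | succ n => exact ⟨n, hn, by simpa [upRen] using e⟩
  | app M N ihM ihN =>
    rcases h with h | h
    · obtain ⟨n, hn, e⟩ := ihM h
      exact ⟨n, Or.inl hn, e⟩
    · obtain ⟨n, hn, e⟩ := ihN h
      exact ⟨n, Or.inr hn, e⟩

/-! ## Confluence -/

theorem Step.subst {M N : Term} (h : Step M N) (t : ℕ → Term) :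
    Step (M.subst t) (N.subst t) := by
  induction h generalizing t with
  | beta M N =>
    rw [subst_inst]
    exact .beta _ _
  | bot_app M => exact .bot_app _
  | lam_bot => exact .lam_bot
  | lam _ ih => exact .lam (ih _)
  | app_left N _ ih => exact .app_left _ (ih t)
  | app_right M _ ih => exact .app_right _ (ih t)

theorem Reduces.subst {M N : Term} (h : Reduces M N) (t : ℕ → Term) :
    Reduces (M.subst t) (N.subst t) :=
  h.lift _ fun _ _ h => h.subst t

theorem Reduces.lam {M N : Term} (h : Reduces M N) : Reduces (.lam M) (.lam N) :=
  h.lift _ fun _ _ h => h.lam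

theorem Reduces.app {M M' N N' : Term} (hM : Reduces M M') (hN : Reduces N N') :
    Reduces (.app M N) (.app M' N') :=
  (hM.lift (fun M => Term.app M N) fun _ _ h => .app_left _ h).trans
    (hN.lift (Term.app M') fun _ _ h => .app_right _ h)

/-- Parallel reduction. -/
inductive Par : Term → Term → Prop
  | var (n : ℕ) : Par (.var n) (.var n)
  | bot : Par .bot .bot
  | lam {M M' : Term} : Par M M' → Par (.lam M) (.lam M')
  | app {M M' N N' : Term} : Par M M' → Par N N' → Par (.app M N) (.app M' N')
  | beta {M M' N N' : Term} : Par M M' → Par N N' → Par (.app (.lam M) N) (inst M' N')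
  | bot_app {M : Term} (N : Term) : Par M .bot → Par (.app M N) .bot
  | lam_bot {M : Term} : Par M .bot → Par (.lam M) .bot

theorem Par.refl (M : Term) : Par M M := by
  induction M with
  | var n => exact .var n
  | bot => exact .bot
  | lam M ih => exact .lam ih
  | app M N ihM ihN => exact .app ihM ihN

theorem Step.par {M N : Term} (h : Step M N) : Par M N := by
  induction h with
  | beta M N => exact .beta (.refl _) (.refl _)
  | bot_app M => exact .bot_app _ .bot
  | lam_bot => exact .lam_bot .bot
  | lam _ ih => exact .lam ih
  | app_left N _ ih => exact .app ih (.refl _)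
  | app_right M _ ih => exact .app (.refl _) ih

theorem Par.reduces {M N : Term} (h : Par M N) : Reduces M N := by
  induction h with
  | var n => exact .refl
  | bot => exact .refl
  | lam _ ih => exact ih.lam
  | app _ _ ihM ihN => exact ihM.app ihN
  | beta _ _ ihM ihN => exact (ihM.lam.app ihN).tail (.beta _ _)
  | bot_app N _ ih => exact (ih.app .refl).tail (.bot_app N)
  | lam_bot _ ih => exact ih.lam.tail .lam_bot

theorem Par.rename {M N : Term} (h : Par M N) (f : ℕ → ℕ) :
    Par (M.rename f) (N.rename f) := by
  induction h generalizing f with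
  | var n => exact .refl _
  | bot => exact .bot
  | lam _ ih => exact .lam (ih _)
  | app _ _ ihM ihN => exact .app (ihM f) (ihN f)
  | beta _ _ ihM ihN =>
    rw [rename_inst]
    exact .beta (ihM _) (ihN f)
  | bot_app N _ ih => exact .bot_app _ (ih f)
  | lam_bot _ ih => exact .lam_bot (ih _)

theorem Par.up {s t : ℕ → Term} (h : ∀ n, Par (s n) (t n)) (n : ℕ) :
    Par (Term.up s n) (Term.up t n) := by
  cases n with
  | zero => exact .refl _
  | succ n => exact (h n).rename _

theorem Par.subst {M N : Term} (h : Par M N) {s t : ℕ → Term} (hs : ∀ n, Par (s n) (t n)) :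
    Par (M.subst s) (N.subst t) := by
  induction h generalizing s t with
  | var n => exact hs n
  | bot => exact .bot
  | lam _ ih => exact .lam (ih (Par.up hs))
  | app _ _ ihM ihN => exact .app (ihM hs) (ihN hs)
  | beta _ _ ihM ihN =>
    rw [subst_inst]
    exact .beta (ihM (Par.up hs)) (ihN hs)
  | bot_app N _ ih => exact .bot_app _ (ih hs)
  | lam_bot _ ih => exact .lam_bot (ih (Par.up hs))

theorem Par.inst {M M' N N' : Term} (hM : Par M M') (hN : Par N N') :
    Par (M.inst N) (M'.inst N') :=
  hM.subst fun n => by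
    cases n with
    | zero => exact hN
    | succ n => exact .var n

theorem Par.eq_bot {M : Term} (h : Par .bot M) : M = .bot := by
  cases h
  rfl

/-- `D` is a complete development of `M`. -/
def IsDevelopment (M D : Term) : Prop := ∀ N, Par M N → Par N D

/-- A subterm that can become `⊥` in one parallel step has development `⊥`, since `⊥` only steps to
itself. Hence the case split on `D = ⊥` decides whether the `⊥`-rule has to fire. -/
theorem IsDevelopment.exists_app {M N D E : Term} (hM : IsDevelopment M D)
    (hN : IsDevelopment N E) (h : ∀ P, M ≠ .lam P) : ∃ F, IsDevelopment (.app M N) F := by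
  by_cases hD : D = .bot
  · subst hD
    refine ⟨.bot, fun P hP => ?_⟩
    cases hP with
    | app h₁ h₂ => exact .bot_app _ (hM _ h₁)
    | beta _ _ => exact (h _ rfl).elim
    | bot_app _ _ => exact .bot
  · refine ⟨.app D E, fun P hP => ?_⟩
    cases hP with
    | app h₁ h₂ => exact .app (hM _ h₁) (hN _ h₂)
    | beta _ _ => exact (h _ rfl).elim
    | bot_app _ h₁ => exact (hD (hM _ h₁).eq_bot).elim

/-- No case split is needed: β and the `⊥`-rules overlap harmlessly, because `⊥` with anything
substituted into it is `⊥`. -/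
theorem IsDevelopment.app_lam {M N D E : Term} (hM : IsDevelopment M D)
    (hN : IsDevelopment N E) : IsDevelopment (.app (.lam M) N) (inst D E) := by
  intro P hP
  have aux : Par M .bot → D = .bot := fun h => (hM _ h).eq_bot
  cases hP with
  | app h₁ h₂ =>
    cases h₁ with
    | lam h₁ => exact .beta (hM _ h₁) (hN _ h₂)
    | lam_bot h₁ =>
      rw [aux h₁]
      exact .bot_app _ .bot
  | beta h₁ h₂ => exact (hM _ h₁).inst (hN _ h₂)
  | bot_app _ h₁ =>
    cases h₁ with
    | lam_bot h₁ =>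
      rw [aux h₁]
      exact .bot

theorem IsDevelopment.exists_lam {M D : Term} (hM : IsDevelopment M D) :
    ∃ F, IsDevelopment (.lam M) F := by
  by_cases hD : D = .bot
  · subst hD
    refine ⟨.bot, fun P hP => ?_⟩
    cases hP with
    | lam h => exact .lam_bot (hM _ h)
    | lam_bot _ => exact .bot
  · refine ⟨.lam D, fun P hP => ?_⟩
    cases hP with
    | lam h => exact .lam (hM _ h)
    | lam_bot h => exact (hD (hM _ h).eq_bot).elim

/-- The second conjunct strengthens the induction: a β-redex needs a development of the body of its
abstraction, which is not an immediate subterm. -/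
theorem exists_isDevelopment (M : Term) :
    (∃ D, IsDevelopment M D) ∧ ∀ P, M = .lam P → ∃ D, IsDevelopment P D := by
  induction M with
  | var n => exact ⟨⟨.var n, fun N h => by cases h; exact .var n⟩, fun _ h => nomatch h⟩
  | bot => exact ⟨⟨.bot, fun N h => by cases h; exact .bot⟩, fun _ h => nomatch h⟩
  | lam M ih =>
    obtain ⟨D, hD⟩ := ih.1
    refine ⟨hD.exists_lam, fun P h => ?_⟩
    cases h
    exact ⟨D, hD⟩
  | app M N ihM ihN =>
    refine ⟨?_, fun _ h => nomatch h⟩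
    obtain ⟨E, hE⟩ := ihN.1
    by_cases h : ∃ P, M = .lam P
    · obtain ⟨P, rfl⟩ := h
      obtain ⟨D, hD⟩ := ihM.2 P rfl
      exact ⟨_, hD.app_lam hE⟩
    · obtain ⟨D, hD⟩ := ihM.1
      exact hD.exists_app hE fun P hP => h ⟨P, hP⟩

theorem reflTransGen_par_iff {M N : Term} : Relation.ReflTransGen Par M N ↔ Reduces M N := by
  constructor
  · intro h
    induction h with
    | refl => exact .refl
    | tail _ h ih => exact ih.trans h.reduces
  · exact fun h => Relation.ReflTransGen.mono (fun _ _ h => Step.par h) _ _ h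

/-- Confluence of reduction. -/
theorem Reduces.conv {M N P : Term} (hN : Reduces M N) (hP : Reduces M P) : Conv N P := by
  rw [← reflTransGen_par_iff] at hN hP
  -- The complete development of the source closes every one-step peak.
  obtain ⟨Q, h₁, h₂⟩ := Relation.church_rosser (r := Par) (fun a b c hb hc => by
    obtain ⟨D, hD⟩ := (exists_isDevelopment a).1
    exact ⟨D, .single (hD _ hb), .single (hD _ hc)⟩) hN hP
  exact ⟨Q, reflTransGen_par_iff.1 h₁, reflTransGen_par_iff.1 h₂⟩

-- Convertibility as a congruence

theorem Conv.refl (M : Term) : Conv M M := ⟨M, .refl, .refl⟩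

theorem Conv.symm {M N : Term} (h : Conv M N) : Conv N M := by
  obtain ⟨P, h₁, h₂⟩ := h
  exact ⟨P, h₂, h₁⟩

theorem Conv.trans {M N P : Term} (h : Conv M N) (h' : Conv N P) : Conv M P := by
  obtain ⟨Q, h₁, h₂⟩ := h
  obtain ⟨Q', h₁', h₂'⟩ := h'
  obtain ⟨S, h₃, h₄⟩ := h₂.conv h₁'
  exact ⟨S, h₁.trans h₃, h₂'.trans h₄⟩

theorem Step.conv {M N : Term} (h : Step M N) : Conv M N := ⟨N, .single h, .refl⟩

theorem Conv.lam {M N : Term} (h : Conv M N) : Conv (.lam M) (.lam N) := by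
  obtain ⟨P, h₁, h₂⟩ := h
  exact ⟨_, h₁.lam, h₂.lam⟩

theorem Conv.app {M M' N N' : Term} (h : Conv M M') (h' : Conv N N') :
    Conv (.app M N) (.app M' N') := by
  obtain ⟨P, h₁, h₂⟩ := h
  obtain ⟨P', h₁', h₂'⟩ := h'
  exact ⟨_, h₁.app h₁', h₂.app h₂'⟩

theorem Conv.subst_left {M N : Term} (h : Conv M N) (t : ℕ → Term) :
    Conv (M.subst t) (N.subst t) := by
  obtain ⟨P, h₁, h₂⟩ := h
  exact ⟨_, h₁.subst t, h₂.subst t⟩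

theorem Conv.subst_right {s t : ℕ → Term} (h : ∀ n, Conv (s n) (t n)) (M : Term) :
    Conv (M.subst s) (M.subst t) := by
  induction M generalizing s t with
  | var n => exact h n
  | bot => exact .refl _
  | lam M ih =>
    refine (ih fun n => ?_).lam
    cases n with
    | zero => exact .refl _
    | succ n =>
      simp only [up, rename_eq_subst]
      exact (h n).subst_left _
  | app M N ihM ihN => exact (ihM h).app (ihN h)

end Term

/-! ## Soundness -/

theorem extend_comp_upRen {D : Type u} (d : D) (V : ℕ → D) (f : ℕ → ℕ) :
    extend d V ∘ Term.upRen f = extend d (V ∘ f) := by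
  funext n
  cases n <;> rfl

/-- The valuation that follows `V` below `K` and an upwards shifted `V'` from `K` on. -/
def merge {D : Type u} (K : ℕ) (V V' : ℕ → D) (n : ℕ) : D := if n < K then V n else V' (n - K)

theorem merge_of_lt {D : Type u} {K n : ℕ} (V V' : ℕ → D) (h : n < K) : merge K V V' n = V n :=
  if_pos h

theorem merge_add {D : Type u} (K : ℕ) (V V' : ℕ → D) (n : ℕ) : merge K V V' (n + K) = V' n := by
  simp [merge]

theorem merge_comp_add {D : Type u} (K : ℕ) (V V' : ℕ → D) : merge K V V' ∘ (· + K) = V' :=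
  funext (merge_add K V V')

namespace Model

variable {D : Type u} (𝓜 : Model D)

theorem interp_extend_congr {M : Term} {V V' : ℕ → D} (d : D)
    (h : ∀ n, Term.FreeIn n (.lam M) → V n = V' n) :
    𝓜.interp M (extend d V) = 𝓜.interp M (extend d V') := by
  refine 𝓜.interp_congr _ _ _ fun n hn => ?_
  cases n with
  | zero => rfl
  | succ n => exact h n hn

/-- Extensionality compares two abstractions only under one common valuation, whereas here the
valuations differ. Only finitely many variables matter, so `merge` packs both valuations into one,
and the copy of `M` shifted by `K` reads its upper part. -/
theorem interp_rename (f : ℕ → ℕ) (M : Term) (V : ℕ → D) :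
    𝓜.interp (M.rename f) V = 𝓜.interp M (V ∘ f) := by
  induction M generalizing f V with
  | var n => simp only [Term.rename, interp_var, Function.comp]
  | bot => simp only [Term.rename, interp_bot]
  | app M N ihM ihN => simp only [Term.rename, interp_app, ihM, ihN]
  | lam M ih =>
    obtain ⟨K₁, hK₁⟩ := (Term.lam M).exists_freeIn_lt
    obtain ⟨K₂, hK₂⟩ := ((Term.lam M).rename f).exists_freeIn_lt
    set K := max K₁ K₂
    have hl₁ : ∀ n, Term.FreeIn n (.lam M) → n < K := fun n hn => lt_max_of_lt_left (hK₁ n hn)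
    have hl₂ : ∀ n, Term.FreeIn n ((Term.lam M).rename f) → n < K :=
      fun n hn => lt_max_of_lt_right (hK₂ n hn)
    calc 𝓜.interp (.lam (M.rename (Term.upRen f))) V
        = 𝓜.interp (.lam (M.rename (Term.upRen f))) (merge K V (V ∘ f)) :=
          𝓜.interp_congr _ _ _ fun n hn => (merge_of_lt _ _ (hl₂ n hn)).symm
      _ = 𝓜.interp (.lam (M.rename (Term.upRen (· + K)))) (merge K V (V ∘ f)) := by
          refine 𝓜.interp_ext _ _ _ fun d => ?_
          rw [𝓜.interp_extend_congr d
            (fun n hn => merge_of_lt V (V ∘ f) (hl₂ n hn)), ih, ih, extend_comp_upRen,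
            extend_comp_upRen, merge_comp_add]
      -- The shifted term has no free variable below `K`, so the lower half of the valuation may be
      -- exchanged.
      _ = 𝓜.interp (.lam (M.rename (Term.upRen (· + K)))) (merge K (V ∘ f) (V ∘ f)) := by
          refine 𝓜.interp_congr _ _ _ fun n hn => ?_
          obtain ⟨m, -, rfl⟩ := Term.FreeIn.of_rename (M := .lam M) hn
          rw [merge_add, merge_add]
      _ = 𝓜.interp (.lam M) (merge K (V ∘ f) (V ∘ f)) := by
          refine 𝓜.interp_ext _ _ _ fun d => ?_
          rw [𝓜.interp_extend_congr d
            (fun n hn => merge_of_lt (V ∘ f) (V ∘ f) (hl₁ n hn)), ih, extend_comp_upRen,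
            merge_comp_add]
      _ = 𝓜.interp (.lam M) (V ∘ f) :=
          𝓜.interp_congr _ _ _ fun n hn => merge_of_lt _ _ (hl₁ n hn)

theorem interp_up (s : ℕ → Term) (V : ℕ → D) (d : D) :
    (fun n => 𝓜.interp (Term.up s n) (extend d V)) =
      extend d fun n => 𝓜.interp (s n) V := by
  funext n
  cases n with
  | zero => exact 𝓜.interp_var _ _
  | succ n => exact 𝓜.interp_rename _ _ _

/-- Under a binder the same device works: the substituted body and the shifted body are compared
under one merged valuation, whose upper part holds the values of `s`. -/
theorem interp_subst (s : ℕ → Term) (M : Term) (V : ℕ → D) :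
    𝓜.interp (M.subst s) V = 𝓜.interp M fun n => 𝓜.interp (s n) V := by
  induction M generalizing s V with
  | var n => simp only [Term.subst, interp_var]
  | bot => simp only [Term.subst, interp_bot]
  | app M N ihM ihN => simp only [Term.subst, interp_app, ihM, ihN]
  | lam M ih =>
    obtain ⟨K, hK⟩ := ((Term.lam M).subst s).exists_freeIn_lt
    set V' : ℕ → D := fun n => 𝓜.interp (s n) V
    calc 𝓜.interp (.lam (M.subst (Term.up s))) V
        = 𝓜.interp (.lam (M.subst (Term.up s))) (merge K V V') :=
          𝓜.interp_congr _ _ _ fun n hn => (merge_of_lt _ _ (hK n hn)).symm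
      _ = 𝓜.interp (.lam (M.rename (Term.upRen (· + K)))) (merge K V V') := by
          refine 𝓜.interp_ext _ _ _ fun d => ?_
          rw [𝓜.interp_extend_congr d (fun n hn => merge_of_lt V V' (hK n hn)), ih,
            interp_rename, extend_comp_upRen, merge_comp_add, interp_up]
      _ = 𝓜.interp (.lam M) V' := by
          have := 𝓜.interp_rename (· + K) (.lam M) (merge K V V')
          rwa [merge_comp_add] at this

theorem interp_inst (M N : Term) (V : ℕ → D) :
    𝓜.interp (M.inst N) V = 𝓜.interp M (extend (𝓜.interp N V) V) := by
  rw [Term.inst, interp_subst]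
  congr 1
  funext n
  cases n with
  | zero => rfl
  | succ n => exact 𝓜.interp_var _ _

theorem interp_step {M N : Term} (h : Term.Step M N) (V : ℕ → D) :
    𝓜.interp M V = 𝓜.interp N V := by
  induction h generalizing V with
  | beta M N => rw [interp_app, interp_lam, interp_inst]
  | bot_app M => rw [interp_app, interp_bot, d₀_app]
  | lam_bot => rw [interp_lam_bot, interp_bot]
  | lam _ ih => exact 𝓜.interp_ext _ _ _ fun d => ih _
  | app_left N _ ih => rw [interp_app, interp_app, ih]
  | app_right M _ ih => rw [interp_app, interp_app, ih]

theorem interp_reduces {M N : Term} (h : Term.Reduces M N) (V : ℕ → D) :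
    𝓜.interp M V = 𝓜.interp N V := by
  induction h with
  | refl => rfl
  | tail _ h ih => rw [ih, 𝓜.interp_step h]

theorem interp_conv {M N : Term} (h : Term.Conv M N) (V : ℕ → D) :
    𝓜.interp M V = 𝓜.interp N V := by
  obtain ⟨P, h₁, h₂⟩ := h
  rw [𝓜.interp_reduces h₁, 𝓜.interp_reduces h₂]

theorem interp_comp (M N : Term) (V : ℕ → D) :
    𝓜.interp (Term.comp M N) V = 𝓜.comp (𝓜.interp M V) (𝓜.interp N V) := by
  rw [Term.comp, interp_app, interp_app, Model.comp,
    𝓜.interp_congr Term.B V fun _ => 𝓜.d₀]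
  intro n hn
  simp [Term.B, Term.FreeIn] at hn

theorem tyInterp_mono (W : ℕ → Set D) {σ τ : Ty} (h : Ty.Le σ τ) :
    𝓜.tyInterp W σ ⊆ 𝓜.tyInterp W τ := by
  induction h with
  | refl σ => exact subset_rfl
  | trans _ _ ih₁ ih₂ => exact ih₁.trans ih₂
  | le_omega σ => exact Set.subset_univ _
  | omega_le => exact fun _ _ _ _ => Set.mem_univ _
  | inter_left σ τ => exact Set.inter_subset_left
  | inter_right σ τ => exact Set.inter_subset_right
  | dup σ => exact fun _ h => ⟨h, h⟩
  | inter_mono _ _ ih₁ ih₂ => exact Set.inter_subset_inter ih₁ ih₂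
  | arrow_mono _ _ ih₁ ih₂ => exact fun d hd e he => ih₂ (hd e (ih₁ he))
  | arrow_inter σ τ ρ => exact fun d hd e he => ⟨hd.1 e he, hd.2 e he⟩

end Model

theorem Typed.interp_mem {D : Type u} (𝓜 : Model D) (W : ℕ → Set D) {Γ : List Ty} {M : Term}
    {σ : Ty} (h : Typed Γ M σ) {V : ℕ → D}
    (hV : ∀ n τ, Γ[n]? = some τ → V n ∈ 𝓜.tyInterp W τ) :
    𝓜.interp M V ∈ 𝓜.tyInterp W σ := by
  induction h generalizing V with
  | ax h =>
    rw [𝓜.interp_var]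
    exact hV _ _ h
  | omega Γ M => exact Set.mem_univ _
  | sub _ hle ih => exact 𝓜.tyInterp_mono W hle (ih hV)
  | lam _ ih =>
    intro e he
    rw [𝓜.interp_lam]
    refine ih fun n τ hn => ?_
    cases n with
    | zero =>
      simp only [List.getElem?_cons_zero, Option.some.injEq] at hn
      exact hn ▸ he
    | succ n => exact hV n τ (by simpa using hn)
  | app _ _ ihM ihN =>
    rw [𝓜.interp_app]
    exact ihM hV _ (ihN hV)
  | inter _ _ ih₁ ih₂ => exact ⟨ih₁ hV, ih₂ hV⟩

theorem Retract.semanticRetract {σ τ : Ty} (h : Retract σ τ) : SemanticRetract.{u} σ τ := by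
  obtain ⟨L, R, hL, hR, hc⟩ := h
  refine ⟨L, R, fun D 𝓜 V W => ⟨hR.interp_mem 𝓜 W ?_, hL.interp_mem 𝓜 W ?_, ?_⟩⟩
  · simp
  · simp
  · rw [← 𝓜.interp_comp, 𝓜.interp_conv hc]

/-! ## Universe lifting of models -/

/-- A model with its domain moved to another universe. -/
def Model.ulift {D : Type} (𝓜 : Model D) : Model (ULift.{u} D) where
  app d e := ⟨𝓜.app d.down e.down⟩
  interp M V := ⟨𝓜.interp M (ULift.down ∘ V)⟩
  d₀ := ⟨𝓜.d₀⟩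
  d₀_app e := by rw [𝓜.d₀_app]
  interp_var n V := by rw [𝓜.interp_var]; rfl
  interp_app M N V := by rw [𝓜.interp_app]
  interp_lam M V d := by
    rw [𝓜.interp_lam]
    congr 2
    funext n
    cases n <;> rfl
  interp_congr M V V' h :=
    congrArg ULift.up (𝓜.interp_congr M _ _ fun n hn => congrArg ULift.down (h n hn))
  interp_ext M N V h := by
    refine congrArg ULift.up (𝓜.interp_ext M N _ fun d => ?_)
    have e : extend d (ULift.down ∘ V) = ULift.down ∘ extend (ULift.up d) V := by
      funext n
      cases n <;> rfl
    rw [e]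
    exact congrArg ULift.down (h ⟨d⟩)
  interp_bot V := by rw [𝓜.interp_bot]
  interp_lam_bot V := by rw [𝓜.interp_lam_bot]

/-- The term and filter models have domains in `Type`, while semantic retraction quantifies over
domains in `Type u`; lifting bridges the gap. -/
theorem Model.tyInterp_ulift {D : Type} (𝓜 : Model D) (W : ℕ → Set D) (σ : Ty) (d : D) :
    ULift.up.{u} d ∈ 𝓜.ulift.tyInterp (fun n => ULift.down ⁻¹' W n) σ ↔ d ∈ 𝓜.tyInterp W σ := by
  induction σ generalizing d with
  | var n => rfl
  | omega => exact Iff.rfl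
  | arrow σ τ ihσ ihτ =>
    constructor
    · exact fun h e he => (ihτ _).1 (h ⟨e⟩ ((ihσ e).2 he))
    · exact fun h e he => (ihτ _).2 (h e.down ((ihσ e.down).1 he))
  | inter σ τ ihσ ihτ => exact and_congr (ihσ d) (ihτ d)

/-! ## The term model -/

namespace Term

/-- Convertibility as an equivalence relation. -/
def convSetoid : Setoid Term := ⟨Conv, .refl, .symm, .trans⟩

/-- Provides a fresh variable. The bound on `n` is essential, as all the `s n` together may use
every variable. -/
theorem exists_freeIn_lt_of_lt (s : ℕ → Term) (b : ℕ) :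
    ∃ k, ∀ n < b, ∀ m, FreeIn m (s n) → m < k := by
  induction b with
  | zero => exact ⟨0, fun n hn => absurd hn n.not_lt_zero⟩
  | succ b ih =>
    obtain ⟨k, hk⟩ := ih
    obtain ⟨l, hl⟩ := (s b).exists_freeIn_lt
    refine ⟨max k l, fun n hn m hm => ?_⟩
    rcases Nat.lt_succ_iff_lt_or_eq.1 hn with hn | rfl
    · exact lt_max_of_lt_left (hk n hn m hm)
    · exact lt_max_of_lt_right (hl m hm)

/-- A fresh `k` put in place of the bound variable can be abstracted again: rename `k` to `0` and
shift all other variables. -/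
theorem subst_subst_fresh {M : Term} {s : ℕ → Term} {k : ℕ}
    (h : ∀ n, FreeIn n (.lam M) → ¬ FreeIn k (s n)) :
    (M.subst (extend (.var k) s)).subst
      (fun n => if n = k then .var 0 else .var (n + 1)) = M.subst (up s) := by
  rw [subst_subst]
  refine subst_congr fun n hn => ?_
  cases n with
  | zero => simp [extend, up, subst]
  | succ n =>
    simp only [Function.comp, extend, up, rename_eq_subst]
    exact subst_congr fun m hm => if_neg fun (e : m = k) => h n hn (e ▸ hm)

/-- Extensionality for abstractions. -/
theorem Conv.lam_subst {M N : Term} {s : ℕ → Term}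
    (h : ∀ k, Conv (M.subst (extend (.var k) s)) (N.subst (extend (.var k) s))) :
    Conv ((Term.lam M).subst s) ((Term.lam N).subst s) := by
  obtain ⟨b, hb⟩ := (Term.lam M).exists_freeIn_lt
  obtain ⟨c, hc⟩ := (Term.lam N).exists_freeIn_lt
  obtain ⟨k, hk⟩ := exists_freeIn_lt_of_lt s (max b c)
  have key := (h k).subst_left fun n => if n = k then .var 0 else .var (n + 1)
  rw [subst_subst_fresh fun n hn hf => (hk n (lt_max_of_lt_left (hb n hn)) k hf).false,
    subst_subst_fresh fun n hn hf => (hk n (lt_max_of_lt_right (hc n hn)) k hf).false] at key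
  exact key.lam

end Term

/-- Terms modulo convertibility. -/
def TermClass : Type := Quotient Term.convSetoid

namespace TermClass

/-- The class of a term. -/
def mk (M : Term) : TermClass := Quotient.mk Term.convSetoid M

/-- A representative of a class. -/
noncomputable def rep (d : TermClass) : Term := Quotient.out d

theorem mk_rep (d : TermClass) : mk d.rep = d := Quotient.out_eq d

theorem mk_eq_mk {M N : Term} : mk M = mk N ↔ Term.Conv M N := Quotient.eq (r := Term.convSetoid)

theorem rep_mk (M : Term) : Term.Conv (mk M).rep M := mk_eq_mk.1 (mk_rep _)

theorem mk_subst_rep (M : Term) : mk (M.subst fun n => (mk (.var n)).rep) = mk M := by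
  have := Term.Conv.subst_right (fun n => rep_mk (.var n)) M
  rw [mk_eq_mk]
  rwa [Term.subst_var] at this

end TermClass

open TermClass in
/-- The model of terms modulo convertibility. -/
noncomputable def termModel : Model TermClass where
  app d e := mk (.app d.rep e.rep)
  interp M V := mk (M.subst fun n => (V n).rep)
  d₀ := mk .bot
  d₀_app e := mk_eq_mk.2 (((rep_mk _).app (.refl _)).trans (Term.Step.bot_app _).conv)
  interp_var n V := mk_rep _
  interp_app M N V := mk_eq_mk.2 ((rep_mk _).app (rep_mk _)).symm
  interp_lam M V d := by
    refine mk_eq_mk.2 (((rep_mk _).app (.refl _)).trans ?_)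
    refine (Term.Step.beta _ _).conv.trans ?_
    rw [Term.inst_subst_up]
    have e : (fun n => Nat.casesOn n d.rep fun n => (V n).rep : ℕ → Term) =
        fun n => (extend d V n).rep := by
      funext n
      cases n <;> rfl
    rw [e]
    exact .refl _
  interp_congr M V V' h := by
    rw [Term.subst_congr fun n hn => congrArg rep (h n hn)]
  interp_ext M N V h := by
    refine mk_eq_mk.2 (Term.Conv.lam_subst fun k => ?_)
    -- Testing on classes of variables suffices, but the chosen representative of such a class is
    -- only convertible to the variable.
    have key : ∀ n, Term.Conv (extend (.var k) (fun n => (V n).rep) n)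
        (extend (mk (.var k)) V n).rep := by
      intro n
      cases n with
      | zero => exact (rep_mk _).symm
      | succ n => exact .refl _
    exact ((Term.Conv.subst_right key M).trans (mk_eq_mk.1 (h (mk (.var k))))).trans
      (Term.Conv.subst_right key N).symm
  interp_bot V := rfl
  interp_lam_bot V := mk_eq_mk.2 Term.Step.lam_bot.conv

theorem conv_of_interp_eq {M N : Term}
    (h : ∀ (D : Type u) (𝓜 : Model D) (V : ℕ → D), 𝓜.interp M V = 𝓜.interp N V) :
    Term.Conv M N := by
  -- When each variable denotes its own class, every term denotes its own class.
  have key := congrArg ULift.down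
    (h _ termModel.ulift fun n => ULift.up (TermClass.mk (.var n)))
  have key' : TermClass.mk (M.subst fun n => (TermClass.mk (.var n)).rep) =
      TermClass.mk (N.subst fun n => (TermClass.mk (.var n)).rep) := key
  rwa [TermClass.mk_subst_rep, TermClass.mk_subst_rep, TermClass.mk_eq_mk] at key'

/-! ## The filter model -/

theorem Ty.Le.inter {σ τ ρ : Ty} (h₁ : Ty.Le σ τ) (h₂ : Ty.Le σ ρ) : Ty.Le σ (.inter τ ρ) :=
  (Ty.Le.dup σ).trans (.inter_mono h₁ h₂)

theorem Ty.Le.arrow_of_omega {τ : Ty} (σ : Ty) (h : Ty.Le .omega τ) :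
    Ty.Le .omega (.arrow σ τ) :=
  Ty.Le.omega_le.trans (.arrow_mono (.le_omega σ) h)

/-- Filters of types. -/
structure TyFilter : Type where
  /-- The types in the filter. -/
  carrier : Set Ty
  omega_mem : Ty.omega ∈ carrier
  mem_of_le : ∀ {σ τ : Ty}, Ty.Le σ τ → σ ∈ carrier → τ ∈ carrier
  inter_mem : ∀ {σ τ : Ty}, σ ∈ carrier → τ ∈ carrier → Ty.inter σ τ ∈ carrier

namespace TyFilter

theorem ext {d e : TyFilter} (h : d.carrier = e.carrier) : d = e := by
  cases d
  cases e
  cases h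
  rfl

instance : Preorder TyFilter := Preorder.lift carrier

/-- The filter of the types above `σ`. -/
def principal (σ : Ty) : TyFilter where
  carrier := {τ | Ty.Le σ τ}
  omega_mem := .le_omega σ
  mem_of_le h h' := h'.trans h
  inter_mem h h' := h.inter h'

theorem principal_le {σ : Ty} {d : TyFilter} (h : σ ∈ d.carrier) : principal σ ≤ d :=
  fun _ hτ => d.mem_of_le hτ h

theorem principal_anti {σ τ : Ty} (h : Ty.Le σ τ) : principal τ ≤ principal σ :=
  principal_le (d := principal σ) h

/-- Application of filters. -/
def app (d e : TyFilter) : TyFilter where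
  carrier := {τ | ∃ σ ∈ e.carrier, Ty.arrow σ τ ∈ d.carrier}
  omega_mem := ⟨.omega, e.omega_mem, d.mem_of_le .omega_le d.omega_mem⟩
  mem_of_le := by
    rintro τ ρ h ⟨σ, hσ, hd⟩
    exact ⟨σ, hσ, d.mem_of_le (.arrow_mono (.refl σ) h) hd⟩
  inter_mem := by
    rintro τ ρ ⟨σ, hσ, hd⟩ ⟨σ', hσ', hd'⟩
    -- Both arrows are first weakened to the common source `σ ∧ σ'`, so that distribution applies.
    refine ⟨_, e.inter_mem hσ hσ', d.mem_of_le (.arrow_inter _ τ ρ) (d.inter_mem ?_ ?_)⟩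
    · exact d.mem_of_le (.arrow_mono (.inter_left _ _) (.refl _)) hd
    · exact d.mem_of_le (.arrow_mono (.inter_right _ _) (.refl _)) hd'

theorem app_mono {d d' e e' : TyFilter} (h : d ≤ d') (h' : e ≤ e') : app d e ≤ app d' e' := by
  rintro τ ⟨σ, hσ, hd⟩
  exact ⟨σ, h' hσ, h hd⟩

/-- The types of a function on filters. -/
def AbsMem (F : TyFilter → TyFilter) : Ty → Prop
  | .var _ => False
  | .omega => True
  | .arrow σ τ => τ ∈ (F (principal σ)).carrier
  | .inter σ τ => AbsMem F σ ∧ AbsMem F τ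

/-- Replaces inversion lemmas for `≤`: `arrow_mono` uses monotonicity of `F`, and `arrow_inter` uses
that the values of `F` are closed under intersection. -/
theorem AbsMem.of_le {F : TyFilter → TyFilter} (hF : Monotone F) {σ τ : Ty} (h : Ty.Le σ τ) :
    AbsMem F σ → AbsMem F τ := by
  induction h with
  | refl σ => exact id
  | trans _ _ ih₁ ih₂ => exact ih₂ ∘ ih₁
  | le_omega σ => exact fun _ => trivial
  | omega_le => exact fun _ => omega_mem _
  | inter_left σ τ => exact And.left
  | inter_right σ τ => exact And.right
  | dup σ => exact fun h => ⟨h, h⟩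
  | inter_mono _ _ ih₁ ih₂ => exact And.imp ih₁ ih₂
  | arrow_mono h₁ h₂ _ _ => exact fun h => hF (principal_anti h₁) (mem_of_le _ h₂ h)
  | arrow_inter σ τ ρ => exact fun h => inter_mem _ h.1 h.2

/-- The filter that represents a monotone function on filters. -/
def abs (F : TyFilter →o TyFilter) : TyFilter where
  carrier := {σ | AbsMem F σ}
  omega_mem := trivial
  mem_of_le h := AbsMem.of_le F.monotone h
  inter_mem := And.intro

theorem abs_mono {F G : TyFilter →o TyFilter} (h : ∀ d, F d ≤ G d) : abs F ≤ abs G := by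
  intro σ hσ
  induction σ with
  | var n => exact hσ
  | omega => trivial
  | arrow σ τ _ _ => exact h _ hσ
  | inter σ τ ihσ ihτ => exact ⟨ihσ hσ.1, ihτ hσ.2⟩

/-- The hypothesis is continuity at `e`; one inclusion is exactly that, the other is monotonicity.
-/
theorem app_abs {F : TyFilter →o TyFilter} {e : TyFilter}
    (hF : ∀ τ ∈ (F e).carrier, ∃ σ ∈ e.carrier, τ ∈ (F (principal σ)).carrier) :
    app (abs F) e = F e := by
  refine ext (Set.Subset.antisymm ?_ fun τ hτ => hF τ hτ)
  rintro τ ⟨σ, hσ, h⟩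
  exact F.monotone (principal_le hσ) h

theorem extend_mono {d e : TyFilter} {V V' : ℕ → TyFilter} (h : d ≤ e) (hV : V ≤ V') :
    extend d V ≤ extend e V' := by
  intro n
  cases n with
  | zero => exact h
  | succ n => exact hV n

/-- The interpretation of terms as monotone functions from valuations to filters. -/
def eval : Term → ((ℕ → TyFilter) →o TyFilter)
  | .var n => ⟨fun V => V n, fun _ _ h => h n⟩
  | .bot => ⟨fun _ => principal .omega, fun _ _ _ => le_rfl⟩
  | .lam M =>
    ⟨fun V => abs ⟨fun d => eval M (extend d V),
        fun _ _ h => (eval M).monotone (extend_mono h le_rfl)⟩,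
      fun _ _ h => abs_mono fun _ => (eval M).monotone (extend_mono le_rfl h)⟩
  | .app M N => ⟨fun V => app (eval M V) (eval N V),
      fun _ _ h => app_mono ((eval M).monotone h) ((eval N).monotone h)⟩

theorem principal_inter_le {V : ℕ → TyFilter} {Γ Δ : ℕ → Ty} {M N : Term} {σ τ : Ty}
    (hΓ : ∀ n, Γ n ∈ (V n).carrier) (hΔ : ∀ n, Δ n ∈ (V n).carrier)
    (hM : σ ∈ (eval M fun n => principal (Γ n)).carrier)
    (hN : τ ∈ (eval N fun n => principal (Δ n)).carrier) :
    ∃ Θ : ℕ → Ty, (∀ n, Θ n ∈ (V n).carrier) ∧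
      σ ∈ (eval M fun n => principal (Θ n)).carrier ∧
      τ ∈ (eval N fun n => principal (Θ n)).carrier :=
  ⟨fun n => .inter (Γ n) (Δ n), fun n => inter_mem _ (hΓ n) (hΔ n),
    (eval M).monotone (fun _ => principal_anti (.inter_left _ _)) hM,
    (eval N).monotone (fun _ => principal_anti (.inter_right _ _)) hN⟩

/-- Continuity of the interpretation. -/
theorem exists_principal_of_mem_eval {M : Term} {V : ℕ → TyFilter} {τ : Ty}
    (h : τ ∈ (eval M V).carrier) :
    ∃ Γ : ℕ → Ty, (∀ n, Γ n ∈ (V n).carrier) ∧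
      τ ∈ (eval M fun n => principal (Γ n)).carrier := by
  induction M generalizing V τ with
  | var m =>
    refine ⟨fun n => if n = m then τ else .omega, fun n => ?_, ?_⟩
    · by_cases hn : n = m
      · simp only [hn, if_true]
        exact h
      · simp only [hn, if_false]
        exact omega_mem _
    · change Ty.Le (if m = m then τ else .omega) τ
      rw [if_pos rfl]
      exact .refl τ
  | bot => exact ⟨fun _ => .omega, fun n => omega_mem _, h⟩
  | app M N ihM ihN =>
    obtain ⟨σ, hN, hM⟩ := h
    obtain ⟨Γ, hΓ, hM⟩ := ihM hM
    obtain ⟨Δ, hΔ, hN⟩ := ihN hN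
    obtain ⟨Θ, hΘ, hM, hN⟩ := principal_inter_le hΓ hΔ hM hN
    exact ⟨Θ, hΘ, σ, hN, hM⟩
  | lam M ih =>
    -- Membership in an abstraction is defined by recursion on the type, hence the inner induction.
    induction τ with
    | var n => exact h.elim
    | omega => exact ⟨fun _ => .omega, fun n => omega_mem _, trivial⟩
    | arrow σ τ _ _ =>
      obtain ⟨Γ, hΓ, hM⟩ := ih (V := extend (principal σ) V) h
      refine ⟨fun n => Γ (n + 1), fun n => hΓ (n + 1), (eval M).monotone (fun n => ?_) hM⟩
      cases n with
      | zero => exact principal_le (hΓ 0)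
      | succ n => exact le_rfl
    | inter σ τ ihσ ihτ =>
      obtain ⟨Γ, hΓ, hσ⟩ := ihσ h.1
      obtain ⟨Δ, hΔ, hτ⟩ := ihτ h.2
      obtain ⟨Θ, hΘ, hσ, hτ⟩ := principal_inter_le hΓ hΔ hσ hτ
      exact ⟨Θ, hΘ, hσ, hτ⟩

theorem eval_congr {M : Term} {V V' : ℕ → TyFilter}
    (h : ∀ n, Term.FreeIn n M → V n = V' n) : eval M V = eval M V' := by
  induction M generalizing V V' with
  | var n => exact h n rfl
  | bot => rfl
  | app M N ihM ihN =>
    change app (eval M V) (eval N V) = app (eval M V') (eval N V')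
    rw [ihM fun n hn => h n (Or.inl hn), ihN fun n hn => h n (Or.inr hn)]
  | lam M ih =>
    refine congrArg abs (OrderHom.ext _ _ (funext fun d => ih fun n hn => ?_))
    cases n with
    | zero => rfl
    | succ n => exact h n hn

/-- Makes `λx.⊥` and `⊥` equal in the filter model: types built from `ω` by such arrows and
intersections are all above `ω`, and no type variable belongs to an abstraction. -/
theorem abs_const_principal_omega :
    abs ⟨fun _ => principal .omega, fun _ _ _ => le_rfl⟩ = principal .omega := by
  refine ext (Set.Subset.antisymm (fun σ hσ => ?_) (principal_le trivial))
  induction σ with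
  | var n => exact hσ.elim
  | omega => exact .refl _
  | arrow σ τ _ _ => exact Ty.Le.arrow_of_omega σ hσ
  | inter σ τ ihσ ihτ => exact Ty.Le.inter (ihσ hσ.1) (ihτ hσ.2)

end TyFilter

open TyFilter in
/-- The filter model. -/
def filterModel : Model TyFilter where
  app := app
  interp M V := eval M V
  d₀ := principal .omega
  d₀_app e := by
    have := app_abs (F := ⟨fun _ => principal .omega, fun _ _ _ => le_rfl⟩) (e := e)
      fun τ hτ => ⟨.omega, e.omega_mem, hτ⟩
    rwa [abs_const_principal_omega] at this
  interp_var n V := rfl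
  interp_app M N V := rfl
  interp_lam M V d := by
    refine app_abs fun τ hτ => ?_
    obtain ⟨Γ, hΓ, h⟩ := exists_principal_of_mem_eval hτ
    refine ⟨Γ 0, hΓ 0, (eval M).monotone (fun n => ?_) h⟩
    cases n with
    | zero => exact le_rfl
    | succ n => exact principal_le (hΓ (n + 1))
  interp_congr M V V' h := eval_congr h
  interp_ext M N V h := congrArg TyFilter.abs (OrderHom.ext _ _ (funext fun d => h d))
  interp_bot V := rfl
  interp_lam_bot V := abs_const_principal_omega

theorem mem_tyInterp_filterModel (σ : Ty) (d : TyFilter) :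
    d ∈ filterModel.tyInterp (fun n => {d | Ty.var n ∈ d.carrier}) σ ↔ σ ∈ d.carrier := by
  induction σ generalizing d with
  | var n => exact Iff.rfl
  | omega => exact iff_of_true (Set.mem_univ _) d.omega_mem
  | arrow σ τ ihσ ihτ =>
    constructor
    · intro h
      -- The principal filter of `σ` is the generic argument of type `σ`.
      have key : τ ∈ (TyFilter.app d (.principal σ)).carrier :=
        (ihτ _).1 (h (.principal σ) ((ihσ _).2 (.refl σ)))
      obtain ⟨σ', hσ', hd⟩ := key
      exact d.mem_of_le (.arrow_mono hσ' (.refl τ)) hd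
    · exact fun h e he => (ihτ (TyFilter.app d e)).2 ⟨σ, (ihσ e).1 he, h⟩
  | inter σ τ ihσ ihτ =>
    refine (and_congr (ihσ d) (ihτ d)).trans ⟨fun h => d.inter_mem h.1 h.2, fun h => ?_⟩
    exact ⟨d.mem_of_le (.inter_left _ _) h, d.mem_of_le (.inter_right _ _) h⟩

/-- The clauses of `eval` mirror the typing rules. Undeclared variables get the filter of `ω`, whose
types are derivable for any term. -/
theorem typed_of_mem_eval {Γ : List Ty} {M : Term} {σ : Ty}
    (h : σ ∈ (TyFilter.eval M fun n => .principal (Γ[n]?.getD .omega)).carrier) :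
    Typed Γ M σ := by
  induction M generalizing Γ σ with
  | var n =>
    have h : Ty.Le (Γ[n]?.getD .omega) σ := h
    cases hn : Γ[n]? with
    | none =>
      rw [hn] at h
      exact .sub (.omega _ _) h
    | some τ =>
      rw [hn] at h
      exact .sub (.ax hn) h
  | bot => exact .sub (.omega _ _) h
  | app M N ihM ihN =>
    obtain ⟨τ, hN, hM⟩ := h
    exact .app (ihM hM) (ihN hN)
  | lam M ih =>
    induction σ with
    | var n => exact h.elim
    | omega => exact .omega _ _
    | arrow σ τ _ _ =>
      refine .lam (ih ?_)
      convert (show τ ∈ (TyFilter.eval M (extend (.principal σ)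
        fun n => .principal (Γ[n]?.getD .omega))).carrier from h) using 3
      funext n
      cases n <;> rfl
    | inter σ τ ihσ ihτ => exact .inter (ihσ h.1) (ihτ h.2)

theorem typed_nil_of_interp_mem {M : Term} {σ : Ty}
    (h : ∀ (D : Type u) (𝓜 : Model D) (V : ℕ → D) (W : ℕ → Set D),
      𝓜.interp M V ∈ 𝓜.tyInterp W σ) : Typed [] M σ := by
  refine typed_of_mem_eval ((mem_tyInterp_filterModel σ _).1 ?_)
  refine (filterModel.tyInterp_ulift.{u} _ σ _).1 ?_
  exact h _ filterModel.ulift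
    (fun n => ULift.up (.principal (([] : List Ty)[n]?.getD .omega))) _

theorem SemanticRetract.retract {σ τ : Ty} (h : SemanticRetract.{u} σ τ) : Retract σ τ := by
  obtain ⟨L, R, h⟩ := h
  refine ⟨L, R, typed_nil_of_interp_mem fun D 𝓜 V W => (h D 𝓜 V W).2.1,
    typed_nil_of_interp_mem fun D 𝓜 V W => (h D 𝓜 V W).1,
    conv_of_interp_eq fun D 𝓜 V => ?_⟩
  rw [𝓜.interp_comp]
  exact (h D 𝓜 V fun _ => ∅).2.2

theorem retract_iff_semanticRetract (σ τ : Ty) : Retract σ τ ↔ SemanticRetract.{u} σ τ :=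
  ⟨Retract.semanticRetract, SemanticRetract.retract⟩

/-! ## Reduction of the strict system to the standard system -/

namespace Ty

theorem IsStrict.components {μ : Ty} (h : IsStrict μ) : μ.components = [μ] := by
  cases h <;> rfl

theorem IsInter.isStrict_of_mem {σ μ : Ty} (h : IsInter σ) (hμ : μ ∈ σ.components) :
    IsStrict μ := by
  induction σ with
  | inter σ τ ihσ ihτ =>
    cases h with
    | strict h => cases h
    | inter h₁ h₂ => exact (List.mem_append.1 hμ).elim (ihσ h₁) (ihτ h₂)
  | _ =>
    cases h with
    | strict h =>
      rw [h.components, List.mem_singleton] at hμ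
      exact hμ ▸ h

theorem components_ne_nil (σ : Ty) : σ.components ≠ [] := by
  induction σ with
  | inter σ τ ihσ _ => simp [components, ihσ]
  | _ => simp [components]

theorem StrictLe.le {σ τ : Ty} (h : StrictLe σ τ) : Le σ τ := by
  induction h with
  | refl _ => exact .refl _
  | trans _ _ ih₁ ih₂ => exact ih₁.trans ih₂
  | le_omega _ => exact .le_omega _
  | omega_le => exact .omega_le
  | inter_left _ _ => exact .inter_left _ _
  | inter_right _ _ => exact .inter_right _ _
  | dup _ => exact .dup _
  | inter_mono _ _ ih₁ ih₂ => exact .inter_mono ih₁ ih₂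
  | arrow_mono _ _ _ _ ih₁ ih₂ => exact .arrow_mono ih₁ ih₂

theorem IsInter.le_of_mem {σ μ : Ty} (h : IsInter σ) (hμ : μ ∈ σ.components) :
    StrictLe σ μ := by
  induction σ with
  | inter σ τ ihσ ihτ =>
    cases h with
    | strict h => cases h
    | inter h₁ h₂ =>
      rcases List.mem_append.1 hμ with hμ | hμ
      · exact (StrictLe.inter_left h₁ h₂).trans (ihσ h₁ hμ)
      · exact (StrictLe.inter_right h₁ h₂).trans (ihτ h₂ hμ)
  | _ =>
    cases h with
    | strict h =>
      rw [h.components, List.mem_singleton] at hμ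
      subst hμ
      exact .refl (.strict h)

theorem IsInter.le_of_forall {σ τ : Ty} (hσ : IsInter σ) (hτ : IsInter τ)
    (h : ∀ μ ∈ τ.components, StrictLe σ μ) : StrictLe σ τ := by
  induction τ with
  | inter τ ρ ihτ ihρ =>
    cases hτ with
    | strict h => cases h
    | inter h₁ h₂ =>
      exact (StrictLe.dup hσ).trans (.inter_mono
        (ihτ h₁ fun μ hμ => h μ (List.mem_append_left _ hμ))
        (ihρ h₂ fun μ hμ => h μ (List.mem_append_right _ hμ)))
  | _ => exact h _ (List.mem_singleton.2 rfl)

/-- A strict type above an intersection is above one of its components. -/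
theorem StrictLe.exists_component {σ τ ν : Ty} (h : StrictLe σ τ) (hν : ν ∈ τ.components) :
    ∃ μ ∈ σ.components, StrictLe μ ν := by
  -- Without the distribution rule, no rule fuses several components into a new one.
  induction h generalizing ν with
  | refl h => exact ⟨ν, hν, .refl (.strict (h.isStrict_of_mem hν))⟩
  | trans _ _ ih₁ ih₂ =>
    obtain ⟨ρ, hρ, h₁⟩ := ih₂ hν
    obtain ⟨μ, hμ, h₂⟩ := ih₁ hρ
    exact ⟨μ, hμ, h₂.trans h₁⟩
  | le_omega h =>
    obtain ⟨μ, hμ⟩ := List.exists_mem_of_ne_nil _ (components_ne_nil _)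
    rw [List.mem_singleton.1 hν]
    exact ⟨μ, hμ, .le_omega (.strict (h.isStrict_of_mem hμ))⟩
  | omega_le =>
    rw [List.mem_singleton.1 hν]
    exact ⟨_, List.mem_singleton.2 rfl, .omega_le⟩
  | inter_left h _ =>
    exact ⟨ν, List.mem_append_left _ hν, .refl (.strict (h.isStrict_of_mem hν))⟩
  | inter_right _ h =>
    exact ⟨ν, List.mem_append_right _ hν, .refl (.strict (h.isStrict_of_mem hν))⟩
  | dup h =>
    have hν := (List.mem_append.1 hν).elim id id
    exact ⟨ν, hν, .refl (.strict (h.isStrict_of_mem hν))⟩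
  | inter_mono _ _ ih₁ ih₂ =>
    rcases List.mem_append.1 hν with hν | hν
    · obtain ⟨μ, hμ, h⟩ := ih₁ hν
      exact ⟨μ, List.mem_append_left _ hμ, h⟩
    · obtain ⟨μ, hμ, h⟩ := ih₂ hν
      exact ⟨μ, List.mem_append_right _ hμ, h⟩
  | arrow_mono h₁ h₂ hσ hμ =>
    rw [List.mem_singleton.1 hν]
    exact ⟨_, List.mem_singleton.2 rfl, .arrow_mono h₁ h₂ hσ hμ⟩

/-- The arrow from `σ` to `τ`, distributed over the intersections in `τ`. -/
def distArrow (σ : Ty) : Ty → Ty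
  | .inter τ ρ => .inter (distArrow σ τ) (distArrow σ ρ)
  | .var n => .arrow σ (.var n)
  | .omega => .arrow σ .omega
  | .arrow τ ρ => .arrow σ (.arrow τ ρ)

/-- The intersection of strict types that is equivalent to a given type. -/
def star : Ty → Ty
  | .var n => .var n
  | .omega => .omega
  | .arrow σ τ => distArrow (star σ) (star τ)
  | .inter σ τ => .inter (star σ) (star τ)

theorem components_distArrow (σ τ : Ty) :
    (distArrow σ τ).components = τ.components.map (.arrow σ) := by
  induction τ with
  | inter τ ρ ihτ ihρ => simp only [distArrow, components, ihτ, ihρ, List.map_append]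
  | _ => rfl

theorem IsInter.distArrow {σ τ : Ty} (hσ : IsInter σ) (hτ : IsInter τ) :
    IsInter (distArrow σ τ) := by
  induction τ with
  | inter τ ρ ihτ ihρ =>
    cases hτ with
    | strict h => cases h
    | inter h₁ h₂ => exact .inter (ihτ h₁) (ihρ h₂)
  | _ =>
    cases hτ with
    | strict h => exact .strict (.arrow hσ h)

theorem isInter_star (σ : Ty) : IsInter σ.star := by
  induction σ with
  | var n => exact .strict (.var n)
  | omega => exact .strict .omega
  | arrow σ τ ihσ ihτ => exact ihσ.distArrow ihτ
  | inter σ τ ihσ ihτ => exact .inter ihσ ihτ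

theorem IsInter.star_eq {σ : Ty} (h : IsInter σ) : σ.star = σ := by
  induction σ with
  | var n => rfl
  | omega => rfl
  | arrow σ τ ihσ ihτ =>
    cases h with
    | strict h =>
      cases h with
      | arrow hσ hτ =>
        rw [star, ihσ hσ, ihτ (.strict hτ)]
        cases hτ <;> rfl
  | inter σ τ ihσ ihτ =>
    cases h with
    | strict h => cases h
    | inter h₁ h₂ => rw [star, ihσ h₁, ihτ h₂]

/-- Under `star` both sides of the distribution rule become the same type. Monotonicity of arrows is
checked component by component. -/
theorem Le.strictLe_star {σ τ : Ty} (h : Le σ τ) : StrictLe σ.star τ.star := by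
  induction h with
  | refl σ => exact .refl (isInter_star σ)
  | trans _ _ ih₁ ih₂ => exact ih₁.trans ih₂
  | le_omega σ => exact .le_omega (isInter_star σ)
  | omega_le => exact .omega_le
  | inter_left σ τ => exact .inter_left (isInter_star σ) (isInter_star τ)
  | inter_right σ τ => exact .inter_right (isInter_star σ) (isInter_star τ)
  | dup σ => exact .dup (isInter_star σ)
  | inter_mono _ _ ih₁ ih₂ => exact .inter_mono ih₁ ih₂
  | @arrow_mono σ₁ σ₂ τ₁ τ₂ _ _ ihσ ihτ =>
    refine (isInter_star (.arrow σ₁ τ₁)).le_of_forall (isInter_star (.arrow σ₂ τ₂))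
      fun μ hμ => ?_
    rw [star, components_distArrow] at hμ
    obtain ⟨ν, hν, rfl⟩ := List.mem_map.1 hμ
    obtain ⟨ρ, hρ, hle⟩ := ihτ.exists_component hν
    refine ((isInter_star (.arrow σ₁ τ₁)).le_of_mem ?_).trans
      (.arrow_mono ((isInter_star τ₁).isStrict_of_mem hρ)
        ((isInter_star τ₂).isStrict_of_mem hν) ihσ hle)
    rw [star, components_distArrow]
    exact List.mem_map.2 ⟨ρ, hρ, rfl⟩
  | arrow_inter σ τ ρ => exact .refl (isInter_star (.arrow σ (.inter τ ρ)))

theorem le_of_mem_components {σ μ : Ty} (h : μ ∈ σ.components) : Le σ μ := by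
  induction σ with
  | inter σ τ ihσ ihτ =>
    rcases List.mem_append.1 h with h | h
    · exact (Le.inter_left _ _).trans (ihσ h)
    · exact (Le.inter_right _ _).trans (ihτ h)
  | _ =>
    rw [List.mem_singleton.1 h]
    exact .refl _

end Ty

-- Comparison of derivations in the two systems

theorem Typed.of_components {Γ : List Ty} {M : Term} {σ : Ty}
    (h : ∀ μ ∈ σ.components, Typed Γ M μ) : Typed Γ M σ := by
  induction σ with
  | inter σ τ ihσ ihτ =>
    exact .inter (ihσ fun μ hμ => h μ (List.mem_append_left _ hμ))
      (ihτ fun μ hμ => h μ (List.mem_append_right _ hμ))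
  | _ => exact h _ (List.mem_singleton.2 rfl)

theorem StrictTyped.typed {Γ : List Ty} {M : Term} {μ : Ty} (h : StrictTyped Γ M μ) :
    Typed Γ M μ := by
  induction h with
  | ax h hμ => exact .sub (.ax h) (Ty.le_of_mem_components hμ)
  | omega Γ M => exact .omega _ _
  | sub _ _ _ hle ih => exact .sub ih hle.le
  | lam _ _ ih => exact .lam ih
  | app _ _ ihM ihN => exact .app ihM (.of_components ihN)

/-- The strict system has no introduction of `∧`, so a translated derivation is a family of strict
ones, one per component. -/
theorem Typed.strictTyped_star {Γ : List Ty} {M : Term} {σ μ : Ty} (h : Typed Γ M σ)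
    (hμ : μ ∈ σ.star.components) : StrictTyped (Γ.map Ty.star) M μ := by
  induction h generalizing μ with
  | ax h => exact .ax (by rw [List.getElem?_map, h, Option.map_some]) hμ
  | omega Γ M =>
    rw [List.mem_singleton.1 hμ]
    exact .omega _ _
  | sub _ hle ih =>
    obtain ⟨ν, hν, h⟩ := hle.strictLe_star.exists_component hμ
    exact .sub ((Ty.isInter_star _).isStrict_of_mem hν)
      ((Ty.isInter_star _).isStrict_of_mem hμ) (ih hν) h
  | lam _ ih =>
    rw [Ty.star, Ty.components_distArrow] at hμ
    obtain ⟨ν, hν, rfl⟩ := List.mem_map.1 hμ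
    exact .lam (Ty.isInter_star _) (ih hν)
  | app _ _ ihM ihN =>
    refine .app (ihM ?_) fun ν hν => ihN hν
    rw [Ty.star, Ty.components_distArrow]
    exact List.mem_map.2 ⟨μ, hμ, rfl⟩
  | inter _ _ ih₁ ih₂ => exact (List.mem_append.1 hμ).elim ih₁ ih₂

theorem strictTyped_iff_typed {M : Term} {μ : Ty} (hμ : Ty.IsStrict μ) :
    StrictTyped [] M μ ↔ Typed [] M μ := by
  refine ⟨StrictTyped.typed, fun h => h.strictTyped_star ?_⟩
  rw [(Ty.IsInter.strict hμ).star_eq, hμ.components]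
  exact List.mem_singleton.2 rfl

theorem strictRetract_iff_retract {μ ν : Ty} (hμ : Ty.IsStrict μ) (hν : Ty.IsStrict ν) :
    StrictRetract μ ν ↔ Retract μ ν :=
  exists₂_congr fun _ _ => and_congr (strictTyped_iff_typed (.arrow (.strict hν) hμ))
    (and_congr_left' (strictTyped_iff_typed (.arrow (.strict hμ) hν)))

end LambdaBot

theorem mainTheorem4 :
    (∀ σ τ : LambdaBot.Ty,
      LambdaBot.Retract σ τ ↔ LambdaBot.SemanticRetract.{u} σ τ) ∧
    (∀ μ ν : LambdaBot.Ty, LambdaBot.Ty.IsStrict μ → LambdaBot.Ty.IsStrict ν →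
      (LambdaBot.StrictRetract μ ν ↔ LambdaBot.SemanticRetract.{u} μ ν)) :=
  ⟨LambdaBot.retract_iff_semanticRetract, fun μ ν hμ hν =>
    (LambdaBot.strictRetract_iff_retract hμ hν).trans
      (LambdaBot.retract_iff_semanticRetract μ ν)⟩
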